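/- For a topological space $X$, let $d(X)$ be the smallest cardinality of a dense subset of $X$, and let the pinning down number $pd(X)$ be the smallest cardinal $\kappa$ such that for every neighborhood assignment $U$ on $X$ (a map assigning to each $x\in X$ an open set $U(x)\ni x$) there is a set $A\subseteq X$ of cardinality $\kappa$ with $A\cap U(x)\neq\emptyset$ for all $x\in X$. For a cardinal $\kappa$, let $\kappa^{+0}=\kappa$, let $\kappa^{+(n+1)}$ be the smallest cardinal greater than $\kappa^{+n}$, and let $\kappa^{+\omega}=\sup_{n<\omega}\kappa^{+n}$. A space is called $0$-dimensional if its clopen subsets form a base of its topology. Then the following three statements are equivalent: 1. $2^\kappa<\kappa^{+\omega}$ for every cardinal $\kappa$; 2. $d(X)=pd(X)$ for every Hausdorff space $X$; 3. $d(X)=pd(X)$ for every $0$-dimensional Hausdorff space $X$. -/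

import Mathlib

open Cardinal Topology

universe u

noncomputable section

/-- The `ω`-th cardinal successor `κ^{+ω} = sup_n κ^{+n}`. -/
def succOmega (κ : Cardinal.{u}) : Cardinal.{u} :=
  ⨆ n : ℕ, Order.succ^[n] κ

/-- The density `d(X)`: the least cardinality of a dense subset of `X`. -/
def topDensity (X : Type u) [TopologicalSpace X] : Cardinal.{u} :=
  sInf {κ | ∃ D : Set X, Dense D ∧ #D = κ}

/-- `U` is a neighborhood assignment on `X`: every `U x` is an open set containing `x`. -/
def IsNhdAssignment {X : Type u} [TopologicalSpace X] (U : X → Set X) : Prop :=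
  ∀ x, IsOpen (U x) ∧ x ∈ U x

/-- `A` pins down `U`: it meets every `U x`. -/
def PinsDown {X : Type u} (A : Set X) (U : X → Set X) : Prop :=
  ∀ x, (A ∩ U x).Nonempty

/-- The pinning down number `pd(X)`: the least cardinal `κ` such that every neighborhood assignment
on `X` is pinned down by a set of size `κ`. -/
def pinningDownNumber (X : Type u) [TopologicalSpace X] : Cardinal.{u} :=
  sInf {κ | ∀ U : X → Set X, IsNhdAssignment U → ∃ A : Set X, #A = κ ∧ PinsDown A U}

/-- `X` is `0`-dimensional: the clopen sets form a base of its topology. -/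
def IsZeroDimensional (X : Type u) [TopologicalSpace X] : Prop :=
  TopologicalSpace.IsTopologicalBasis {s : Set X | IsClopen s}

end

/-! Always `pd ≤ d`. Given 1 and infinite κ = pd(X), a maximal disjoint family of neat open sets (at
most κ many) reduces density to a neat Y. Distinct points can be chosen in any |Y| nonempty open
sets, so some set of size ≤ κ meets them all (`exists_meets_family`). With the Hausdorff property
this gives |Y| ≤ 2^(2^κ), hence |Y| ≤ κ^{+n} for some n. Were no set of size ≤ κ dense, one such set
would meet the complements of the closures of a cofinal family of κ-sized sets, yet lie inside one
of them.

If κ^{+ω} ≤ 2^κ, the product of the κ^{+(n+1)} has size ≤ 2^κ, so an independent family with κ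
parameters prescribes values on finitely many of its elements g. Truncating to g(n) ≤ a yields
points (n, a, ξ) of a Cantor cube. A g dominating κ given points shows that they are not dense; one
bound per level suffices to pin down an assignment. -/

/-! ### Cardinal arithmetic and combinatorics -/

theorem bddAbove_range_succ_iterate (κ : Cardinal.{u}) :
    BddAbove (Set.range fun n : ℕ => Order.succ^[n] κ) :=
  Cardinal.bddAbove_of_small

theorem le_succ_iterate (κ : Cardinal.{u}) (n : ℕ) : κ ≤ Order.succ^[n] κ :=
  Function.id_le_iterate_of_id_le (fun c => Order.le_succ c) n κ

theorem natCast_le_succ_iterate (κ : Cardinal.{u}) (n : ℕ) : (n : Cardinal) ≤ Order.succ^[n] κ := by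
  induction n with
  | zero => simp
  | succ n ih =>
    rw [Function.iterate_succ_apply', Nat.cast_succ]
    exact Cardinal.add_one_le_of_lt (Order.lt_succ_of_le ih)

theorem two_power_lt_succOmega_of_lt_aleph0 {κ : Cardinal.{u}} (hκ : κ < ℵ₀) :
    2 ^ κ < succOmega κ := by
  obtain ⟨n, rfl⟩ := Cardinal.lt_aleph0.1 hκ
  refine lt_of_lt_of_le ?_ (le_ciSup (bddAbove_range_succ_iterate _) (2 ^ n + 1))
  refine lt_of_lt_of_le ?_ (natCast_le_succ_iterate _ _)
  exact_mod_cast Nat.lt_succ_self (2 ^ n)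

theorem exists_two_power_two_power_le {κ : Cardinal.{u}}
    (h : ∀ κ : Cardinal.{u}, 2 ^ κ < succOmega κ) :
    ∃ n : ℕ, (2 : Cardinal) ^ (2 : Cardinal) ^ κ ≤ Order.succ^[n] κ := by
  obtain ⟨n, hn⟩ := exists_lt_of_lt_ciSup' (h κ)
  obtain ⟨m, hm⟩ := exists_lt_of_lt_ciSup' (h (Order.succ^[n] κ))
  refine ⟨m + n, ?_⟩
  rw [Function.iterate_add_apply]
  exact (Cardinal.power_le_power_left two_ne_zero hn.le).trans hm.le

theorem exists_forall_lt_of_mk_le {κ : Cardinal.{u}} (hκ : ℵ₀ ≤ κ)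
    (s : Set (Order.succ κ).ord.ToType) (hs : #s ≤ κ) : ∃ b, ∀ a ∈ s, a < b := by
  by_contra! hb
  have h := Order.cof_le (s := s) hb
  rw [Ordinal.cof_toType, (isRegular_succ hκ).cof_ord] at h
  exact (Order.lt_succ κ).not_ge (h.trans hs)

/-- The subsets of size at most `κ` of a set of size at most `κ^{+n}` have a cofinal family of
size at most `κ^{+n}`. -/
theorem exists_cofinal_family {κ : Cardinal.{u}} (hκ : ℵ₀ ≤ κ) (n : ℕ) :
    ∀ α : Type u, #α ≤ Order.succ^[n] κ → ∃ (ι : Type u) (F : ι → Set α),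
      #ι ≤ Order.succ^[n] κ ∧ (∀ i, #(F i) ≤ κ) ∧ ∀ A : Set α, #A ≤ κ → ∃ i, A ⊆ F i := by
  induction n with
  | zero =>
    intro α hα
    refine ⟨PUnit, fun _ => Set.univ, ?_, fun _ => by simpa using hα,
      fun A _ => ⟨⟨⟩, Set.subset_univ _⟩⟩
    simpa using Cardinal.one_le_aleph0.trans hκ
  | succ n ih =>
    intro α hα
    rw [Function.iterate_succ_apply'] at hα ⊢
    set μ := Order.succ^[n] κ with hμ
    have hκμ : κ ≤ μ := le_succ_iterate κ n
    rw [← mk_ord_toType (Order.succ μ)] at hα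
    obtain ⟨j⟩ := hα
    have hcard : ∀ b, #{a | j a < b} ≤ μ := fun b => by
      have hb : #(Set.Iio b) < Order.succ μ := by
        simpa using mk_Iio_lt b (by simp)
      refine le_trans ?_ (Order.lt_succ_iff.1 hb)
      exact Cardinal.mk_le_of_injective (f := fun a => (⟨j a.1, a.2⟩ : Set.Iio b))
        fun a a' h => Subtype.ext (j.injective (congrArg Subtype.val h))
    choose ι F hι hF hA using fun b => ih _ (hcard b)
    refine ⟨Σ b, ι b, fun p => Subtype.val '' F p.1 p.2, ?_,
      fun p => mk_image_le.trans (hF _ _), fun A hAκ => ?_⟩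
    · rw [mk_sigma]
      refine (sum_le_sum _ (fun _ => μ) hι).trans ?_
      rw [sum_const', mk_ord_toType]
      exact Cardinal.mul_le_of_le ((hκ.trans hκμ).trans (Order.le_succ μ)) le_rfl
        (Order.le_succ μ)
    -- By regularity of the successor of `μ`, `A` lies in a proper initial segment, which the
    -- induction hypothesis handles.
    · obtain ⟨b, hb⟩ := exists_forall_lt_of_mk_le (hκ.trans hκμ) (j '' A)
        (mk_image_le.trans (hAκ.trans hκμ))
      obtain ⟨i, hi⟩ := hA b (Subtype.val ⁻¹' A)
        ((mk_preimage_of_injective _ _ Subtype.val_injective).trans hAκ)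
      exact ⟨⟨b, i⟩, fun a ha => ⟨⟨a, hb _ ⟨a, ha, rfl⟩⟩, hi ha, rfl⟩⟩

/-- Recursion along a well-order of minimal type: fewer than `#ι` points are used before stage `i`,
so `V i` has a fresh one. -/
theorem exists_injective_forall_mem {ι X : Type u} (V : ι → Set X) (hV : ∀ i, #ι ≤ #(V i)) :
    ∃ x : ι → X, Function.Injective x ∧ ∀ i, x i ∈ V i := by
  obtain ⟨_, _, hord⟩ := Cardinal.exists_ord_eq_type_lt ι
  have key : ∀ (i : ι) (f : Set.Iio i → X), ∃ z ∈ V i, ∀ j, f j ≠ z := fun i f => by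
    by_contra! hz
    have h1 : V i ⊆ Set.range f := fun z hzV => hz z hzV
    exact (mk_Iio_lt i hord).not_ge (((hV i).trans (mk_le_mk_of_subset h1)).trans mk_range_le)
  choose! g hgV hg using key
  let x : ι → X := wellFounded_lt.fix fun i f => g i fun j => f j.1 j.2
  have hx : ∀ i, x i = g i fun j => x j.1 := fun i => wellFounded_lt.fix_eq _ i
  have hne : ∀ i j, j < i → x j ≠ x i := fun i j hji => by
    rw [hx i]
    exact hg i (fun j => x j.1) ⟨j, hji⟩
  refine ⟨x, fun i j hij => ?_, fun i => by rw [hx i]; exact hgV _ _⟩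
  rcases lt_trichotomy i j with h | h | h
  · exact absurd hij (hne _ _ h)
  · exact h
  · exact absurd hij.symm (hne _ _ h)

/-! ### Pinning down and density in Hausdorff spaces -/

section Topology

variable {X : Type u} [TopologicalSpace X] {κ : Cardinal.{u}}

theorem exists_meets_family
    (hp : ∀ U : X → Set X, IsNhdAssignment U → ∃ A : Set X, #A ≤ κ ∧ PinsDown A U)
    (hΔ : ∀ V : Set X, IsOpen V → V.Nonempty → #X ≤ #V) {ι : Type u} (hι : #ι ≤ #X)
    (V : ι → Set X) (hV : ∀ i, IsOpen (V i)) (hne : ∀ i, (V i).Nonempty) :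
    ∃ A : Set X, #A ≤ κ ∧ ∀ i, (A ∩ V i).Nonempty := by
  classical
  obtain ⟨x, hx, hxV⟩ := exists_injective_forall_mem V fun i => hι.trans (hΔ _ (hV i) (hne i))
  let U : X → Set X := Function.extend x V fun _ => Set.univ
  have hUx : ∀ i, U (x i) = V i := fun i => hx.extend_apply _ _ _
  obtain ⟨A, hA, hAU⟩ := hp U fun z => by
    by_cases h : ∃ i, x i = z
    · obtain ⟨i, rfl⟩ := h
      rw [hUx]
      exact ⟨hV i, hxV i⟩
    · simp [U, Function.extend_apply' _ _ _ h]
  exact ⟨A, hA, fun i => hUx i ▸ hAU (x i)⟩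

theorem mk_le_two_power_two_power [T2Space X] (hκ : ℵ₀ ≤ κ)
    (hp : ∀ U : X → Set X, IsNhdAssignment U → ∃ A : Set X, #A ≤ κ ∧ PinsDown A U)
    (hΔ : ∀ V : Set X, IsOpen V → V.Nonempty → #X ≤ #V) : #X ≤ 2 ^ (2 : Cardinal) ^ κ := by
  rcases lt_or_ge #X ℵ₀ with hX | hX
  · exact hX.le.trans (hκ.trans ((cantor κ).le.trans (cantor _).le))
  have hsep : ∀ p : X × X, ∃ u v : Set X, IsOpen u ∧ IsOpen v ∧
      (p.1 ≠ p.2 → p.1 ∈ u ∧ p.2 ∈ v ∧ Disjoint u v) := fun p => by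
    by_cases h : p.1 = p.2
    · exact ⟨∅, ∅, isOpen_empty, isOpen_empty, fun h' => absurd h h'⟩
    · obtain ⟨u, v, hu, hv, h⟩ := t2_separation h
      exact ⟨u, v, hu, hv, fun _ => h⟩
  choose u v hu hv huv using hsep
  obtain ⟨A, hA, hAV⟩ := exists_meets_family hp hΔ
    (ι := {q : (X × X) × (X × X) // (u q.1 ∩ v q.2).Nonempty})
    ((mk_subtype_le _).trans (by simp [mul_eq_self hX]))
    (fun q => u q.1.1 ∩ v q.1.2) (fun q => (hu _).inter (hv _)) (fun q => q.2)
  -- A point is coded by the traces on `A` of the chosen sets `u p` around it. Since `A` meets each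
  -- nonempty `u p ∩ v q`, no `u p` around `y` has the same trace as a `u q` disjoint from `v q ∋
  -- y`.
  let φ : X → Set (Set A) := fun x => {s | ∃ p, x ∈ u p ∧ s = Subtype.val ⁻¹' u p}
  have hφ : Function.Injective φ := fun x y hxy => by
    by_contra hne
    obtain ⟨hxu, hyv, hd⟩ := huv (x, y) hne
    have hmem : (Subtype.val ⁻¹' u (x, y) : Set A) ∈ φ y := hxy ▸ ⟨_, hxu, rfl⟩
    obtain ⟨p, hp, hpe⟩ := hmem
    obtain ⟨a, haA, hau, hav⟩ := hAV ⟨(p, (x, y)), ⟨y, hp, hyv⟩⟩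
    have : (⟨a, haA⟩ : A) ∈ (Subtype.val ⁻¹' u (x, y) : Set A) := hpe ▸ hau
    exact Set.disjoint_left.1 hd this hav
  have h := mk_le_of_injective hφ
  rw [mk_set, mk_set] at h
  exact h.trans (power_le_power_left two_ne_zero (power_le_power_left two_ne_zero hA))

theorem exists_dense_of_mk_le_succ_iterate (hκ : ℵ₀ ≤ κ)
    (hp : ∀ U : X → Set X, IsNhdAssignment U → ∃ A : Set X, #A ≤ κ ∧ PinsDown A U)
    (hΔ : ∀ V : Set X, IsOpen V → V.Nonempty → #X ≤ #V) (hX : ∃ n, #X ≤ Order.succ^[n] κ) :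
    ∃ D : Set X, Dense D ∧ #D ≤ κ := by
  classical
  by_contra! hD
  obtain ⟨n, hn, hmin⟩ := Nat.findX hX
  -- Minimality of `n` makes the cofinal family no larger than `X`.
  have hXn : Order.succ^[n] κ ≤ #X := by
    cases n with
    | zero => simpa using (hD Set.univ dense_univ).le
    | succ m =>
      rw [Function.iterate_succ_apply']
      exact Order.succ_le_of_lt (not_le.1 (hmin m m.lt_succ_self))
  obtain ⟨ι, F, hι, hF, hcof⟩ := exists_cofinal_family hκ n X hn
  obtain ⟨A, hA, hAV⟩ := exists_meets_family hp hΔ (hι.trans hXn) (fun i => (closure (F i))ᶜ)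
    (fun i => isClosed_closure.isOpen_compl) (fun i => by
      rw [Set.nonempty_compl]
      exact fun h => (hD _ (dense_iff_closure_eq.2 h)).not_ge (hF i))
  obtain ⟨i, hi⟩ := hcof A hA
  obtain ⟨a, haA, haF⟩ := hAV i
  exact haF (subset_closure (hi haA))

/-- `Y` is a nonempty open set all of whose nonempty open subsets have the same size as `Y`. -/
def IsNeat (Y : Set X) : Prop :=
  IsOpen Y ∧ Y.Nonempty ∧ ∀ V ⊆ Y, IsOpen V → V.Nonempty → #Y ≤ #V

theorem exists_isNeat_subset {V : Set X} (hV : IsOpen V) (hne : V.Nonempty) :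
    ∃ Y ⊆ V, IsNeat Y := by
  obtain ⟨Y, ⟨hYV, hY, hYne⟩, hmin⟩ := (InvImage.wf (fun Y : Set X => #Y) Cardinal.lt_wf).has_min
    {Y : Set X | Y ⊆ V ∧ IsOpen Y ∧ Y.Nonempty} ⟨V, subset_rfl, hV, hne⟩
  exact ⟨Y, hYV, hY, hYne, fun W hWY hW hWne => not_lt.1 (hmin W ⟨hWY.trans hYV, hW, hWne⟩)⟩

/-- Assign to each point of a member that member: a pinning set then has a point in each. -/
theorem mk_le_of_pairwiseDisjoint
    (hp : ∀ U : X → Set X, IsNhdAssignment U → ∃ A : Set X, #A ≤ κ ∧ PinsDown A U)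
    {c : Set (Set X)} (hc : ∀ Y ∈ c, IsOpen Y ∧ Y.Nonempty) (hd : c.PairwiseDisjoint id) :
    #c ≤ κ := by
  classical
  let U : X → Set X := fun x => if h : ∃ Y ∈ c, x ∈ Y then h.choose else Set.univ
  have hU : ∀ Y ∈ c, ∀ x ∈ Y, U x = Y := fun Y hY x hx => by
    have h : ∃ Y ∈ c, x ∈ Y := ⟨Y, hY, hx⟩
    simp only [U, dif_pos h]
    exact hd.elim_set h.choose_spec.1 hY x h.choose_spec.2 hx
  obtain ⟨A, hA, hAU⟩ := hp U fun x => by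
    by_cases h : ∃ Y ∈ c, x ∈ Y
    · obtain ⟨Y, hY, hx⟩ := h
      rw [hU Y hY x hx]
      exact ⟨(hc Y hY).1, hx⟩
    · simp [U, dif_neg h]
  have hmeet : ∀ Y : c, ∃ a : A, a.1 ∈ Y.1 := fun Y => by
    obtain ⟨x, hx⟩ := (hc Y Y.2).2
    obtain ⟨a, haA, ha⟩ := hAU x
    exact ⟨⟨a, haA⟩, hU Y Y.2 x hx ▸ ha⟩
  choose a ha using hmeet
  refine (mk_le_of_injective (f := a) fun Y Z h => Subtype.ext ?_).trans hA
  exact hd.elim_set Y.2 Z.2 _ (ha Y) (h ▸ ha Z)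

theorem exists_dense_of_forall_isNeat (hκ : ℵ₀ ≤ κ)
    (hp : ∀ U : X → Set X, IsNhdAssignment U → ∃ A : Set X, #A ≤ κ ∧ PinsDown A U)
    (hN : ∀ Y : Set X, IsNeat Y → ∃ D : Set X, #D ≤ κ ∧ Y ⊆ closure D) :
    ∃ D : Set X, Dense D ∧ #D ≤ κ := by
  obtain ⟨c, hc⟩ := zorn_subset
    {c : Set (Set X) | (∀ Y ∈ c, IsNeat Y) ∧ c.PairwiseDisjoint id} fun C hC hchain =>
      ⟨⋃₀ C, ⟨fun Y ⟨c, hcC, hYc⟩ => (hC hcC).1 Y hYc,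
        (Set.pairwiseDisjoint_sUnion hchain.directedOn).2 fun c hcC => (hC hcC).2⟩,
        fun c => Set.subset_sUnion_of_mem⟩
  obtain ⟨⟨hcN, hcd⟩, hmax⟩ := hc
  have hcκ : #c ≤ κ := mk_le_of_pairwiseDisjoint hp (fun Y hY => ⟨(hcN Y hY).1, (hcN Y hY).2.1⟩) hcd
  choose D hDκ hD using fun Y : c => hN Y (hcN Y Y.2)
  refine ⟨⋃ Y, D Y, ?_, ?_⟩
  · rw [dense_iff_inter_open]
    intro V hV hVne
    obtain ⟨Z, hZV, hZ⟩ := exists_isNeat_subset hV hVne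
    obtain ⟨Y, hY, x, hxY, hxZ⟩ : ∃ Y ∈ c, (Y ∩ Z).Nonempty := by
      by_contra! hdis
      have hins : insert Z c ∈ {c : Set (Set X) | (∀ Y ∈ c, IsNeat Y) ∧ c.PairwiseDisjoint id} :=
        ⟨by rintro Y (rfl | hY); exacts [hZ, hcN Y hY],
          hcd.insert fun Y hY _ => (Set.disjoint_iff_inter_eq_empty.2 (hdis Y hY)).symm⟩
      have hZc : Z ∈ c := hmax hins (Set.subset_insert _ _) (Set.mem_insert _ _)
      exact hZ.2.1.ne_empty (by simpa using hdis Z hZc)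
    obtain ⟨d, hdZ, hdD⟩ := mem_closure_iff.1 (hD ⟨Y, hY⟩ hxY) Z hZ.1 hxZ
    exact ⟨d, hZV hdZ, Set.mem_iUnion.2 ⟨_, hdD⟩⟩
  · refine mk_iUnion_le_sum_mk.trans ((sum_le_sum _ (fun _ => κ) hDκ).trans ?_)
    rw [sum_const']
    exact mul_le_of_le hκ hcκ le_rfl

theorem exists_pinsDown_subtype
    (hp : ∀ U : X → Set X, IsNhdAssignment U → ∃ A : Set X, #A ≤ κ ∧ PinsDown A U)
    {Y : Set X} (hY : IsOpen Y) (U : Y → Set Y) (hU : IsNhdAssignment U) :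
    ∃ A : Set Y, #A ≤ κ ∧ PinsDown A U := by
  classical
  obtain ⟨A, hA, hAU⟩ := hp (fun x => if h : x ∈ Y then Subtype.val '' U ⟨x, h⟩ else Set.univ)
    fun x => by
      by_cases h : x ∈ Y
      · simp only [dif_pos h]
        exact ⟨hY.isOpenMap_subtype_val _ (hU _).1, ⟨x, h⟩, (hU _).2, rfl⟩
      · simp [dif_neg h]
  refine ⟨Subtype.val ⁻¹' A, (mk_preimage_of_injective _ _ Subtype.val_injective).trans hA,
    fun y => ?_⟩
  obtain ⟨a, haA, ha⟩ := hAU y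
  simp only [dif_pos y.2] at ha
  obtain ⟨b, hb, rfl⟩ := ha
  exact ⟨b, haA, hb⟩

theorem exists_dense_of_aleph0_le [T2Space X] (h : ∀ κ : Cardinal.{u}, 2 ^ κ < succOmega κ)
    (hκ : ℵ₀ ≤ κ)
    (hp : ∀ U : X → Set X, IsNhdAssignment U → ∃ A : Set X, #A ≤ κ ∧ PinsDown A U) :
    ∃ D : Set X, Dense D ∧ #D ≤ κ := by
  refine exists_dense_of_forall_isNeat hκ hp fun Y hY => ?_
  have hpY := exists_pinsDown_subtype hp hY.1
  have hΔ : ∀ V : Set Y, IsOpen V → V.Nonempty → #Y ≤ #V := fun V hV hne => by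
    have := hY.2.2 (Subtype.val '' V) (by simp) (hY.1.isOpenMap_subtype_val V hV) (hne.image _)
    rwa [mk_image_eq Subtype.val_injective] at this
  obtain ⟨n, hn⟩ := exists_two_power_two_power_le (κ := κ) h
  obtain ⟨D, hD, hDκ⟩ := exists_dense_of_mk_le_succ_iterate hκ hpY hΔ
    ⟨n, (mk_le_two_power_two_power hκ hpY hΔ).trans hn⟩
  exact ⟨Subtype.val '' D, mk_image_le.trans hDκ, Subtype.dense_iff.1 hD⟩

theorem mk_le_of_lt_aleph0 [T2Space X] (hκ : κ < ℵ₀)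
    (hp : ∀ U : X → Set X, IsNhdAssignment U → ∃ A : Set X, #A ≤ κ ∧ PinsDown A U) : #X ≤ κ := by
  by_contra! hX
  obtain ⟨n, rfl⟩ := lt_aleph0.1 hκ
  obtain ⟨s, hs⟩ := (Cardinal.le_mk_iff_exists_subset (s := (Set.univ : Set X))
    (c := ((n + 1 : ℕ) : Cardinal))).1 (by
      rw [mk_univ, Nat.cast_succ, ← succ_natCast]
      exact Order.succ_le_of_lt hX)
  have hfin : s.Finite := lt_aleph0_iff_set_finite.1 (hs.2 ▸ natCast_lt_aleph0)
  obtain ⟨V, hV, hd⟩ := hfin.t2_separation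
  have hinj : Set.InjOn V s := fun x hx y hy hxy => by
    by_contra hne
    have := hd hx hy hne
    exact Set.disjoint_left.1 this (hV x).1 (hxy ▸ (hV x).1)
  have h := mk_le_of_pairwiseDisjoint hp (c := V '' s)
    (by rintro _ ⟨x, -, rfl⟩; exact ⟨(hV x).2, x, (hV x).1⟩)
    (by
      rintro _ ⟨x, hx, rfl⟩ _ ⟨y, hy, rfl⟩ hne
      exact hd hx hy fun e => hne (e ▸ rfl))
  rw [mk_image_eq_of_injOn _ _ hinj, hs.2] at h
  exact absurd (Nat.cast_le.1 h) (by omega)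

/-- The definition asks for exact cardinality, so pinning sets are padded to size `κ`, or all of `X`
is used if it is smaller. -/
theorem pinningDownNumber_le (hκ : ℵ₀ ≤ κ)
    (hp : ∀ U : X → Set X, IsNhdAssignment U → ∃ A : Set X, #A ≤ κ ∧ PinsDown A U) :
    pinningDownNumber X ≤ κ := by
  rcases le_total κ #X with hX | hX
  · refine csInf_le' fun U hU => ?_
    obtain ⟨A, hA, hAU⟩ := hp U hU
    obtain ⟨C, hC⟩ := le_mk_iff_exists_set.1 hX
    refine ⟨A ∪ C, le_antisymm ?_ ?_, fun x => (hAU x).mono ?_⟩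
    · exact (mk_union_le A C).trans (add_le_of_le hκ hA hC.le)
    · exact hC.ge.trans (mk_le_mk_of_subset Set.subset_union_right)
    · exact Set.inter_subset_inter_left _ Set.subset_union_left
  · refine (csInf_le' fun U hU => ?_).trans hX
    exact ⟨Set.univ, mk_univ, fun x => ⟨x, trivial, (hU x).2⟩⟩

theorem exists_pinsDown_mk_eq_pinningDownNumber {U : X → Set X} (hU : IsNhdAssignment U) :
    ∃ A : Set X, #A = pinningDownNumber X ∧ PinsDown A U :=
  csInf_mem (s := {κ | ∀ U : X → Set X, IsNhdAssignment U → ∃ A : Set X, #A = κ ∧ PinsDown A U})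
    ⟨#X, fun _ hU => ⟨Set.univ, mk_univ, fun x => ⟨x, trivial, (hU x).2⟩⟩⟩ U hU

theorem exists_dense_mk_eq_topDensity : ∃ D : Set X, Dense D ∧ #D = topDensity X :=
  csInf_mem (s := {κ | ∃ D : Set X, Dense D ∧ #D = κ}) ⟨_, Set.univ, dense_univ, rfl⟩

theorem pinningDownNumber_le_topDensity : pinningDownNumber X ≤ topDensity X := by
  obtain ⟨D, hD, hDκ⟩ := exists_dense_mk_eq_topDensity (X := X)
  exact csInf_le' fun U hU =>
    ⟨D, hDκ, fun x => Set.inter_comm D _ ▸ hD.inter_open_nonempty _ (hU x).1 ⟨x, (hU x).2⟩⟩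

theorem topDensity_le {D : Set X} (hD : Dense D) : topDensity X ≤ #D :=
  csInf_le' (show #D ∈ {κ | ∃ D : Set X, Dense D ∧ #D = κ} from ⟨D, hD, rfl⟩)

end Topology

theorem topDensity_eq_pinningDownNumber_of_two_power_lt
    (h : ∀ κ : Cardinal.{u}, 2 ^ κ < succOmega κ) (X : Type u) [TopologicalSpace X] [T2Space X] :
    topDensity X = pinningDownNumber X := by
  refine le_antisymm ?_ pinningDownNumber_le_topDensity
  have hp : ∀ U : X → Set X, IsNhdAssignment U →
      ∃ A : Set X, #A ≤ pinningDownNumber X ∧ PinsDown A U := fun U hU => by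
    obtain ⟨A, hA, hAU⟩ := exists_pinsDown_mk_eq_pinningDownNumber hU
    exact ⟨A, hA.le, hAU⟩
  rcases lt_or_ge (pinningDownNumber X) ℵ₀ with hκ | hκ
  · exact (topDensity_le dense_univ).trans (mk_univ.le.trans (mk_le_of_lt_aleph0 hκ hp))
  · obtain ⟨D, hD, hDκ⟩ := exists_dense_of_aleph0_le h hκ hp
    exact (topDensity_le hD).trans hDκ

/-! ### The counterexample when κ^{+ω} ≤ 2^κ -/

/-- An independent family of functions on a set of size `#K`, indexed by the subsets of `K`. -/
def independentFamily {K : Type u} (s : Set K) (ξ : Finset K × Finset (Finset K)) : Prop :=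
  ∃ t ∈ ξ.2, ∀ a, a ∈ t ↔ a ∈ ξ.1 ∧ a ∈ s

theorem exists_independentFamily_iff {K : Type u} (T : Finset (Set K)) (p : Set K → Prop) :
    ∃ ξ : Finset K × Finset (Finset K), ∀ s ∈ T, independentFamily s ξ ↔ p s := by
  classical
  have hsep : ∀ q : Set K × Set K, ∃ F : Finset K, q.1 ≠ q.2 → ∃ a ∈ F, ¬(a ∈ q.1 ↔ a ∈ q.2) :=
    fun q => by
      by_cases h : q.1 = q.2
      · exact ⟨∅, fun h' => absurd h h'⟩
      · obtain ⟨a, ha⟩ : ∃ a, ¬(a ∈ q.1 ↔ a ∈ q.2) := by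
          by_contra! h'
          exact h (Set.ext h')
        exact ⟨{a}, fun _ => ⟨a, Finset.mem_singleton_self a, ha⟩⟩
  choose F hF using hsep
  -- Members of `T` have distinct traces on the finite set `E`, so listing the traces to accept
  -- decides each of them.
  let E : Finset K := (T ×ˢ T).biUnion F
  refine ⟨(E, (T.filter p).image fun s => E.filter (· ∈ s)), fun s hs => ⟨?_, fun hps => ?_⟩⟩
  · rintro ⟨t, ht, hts⟩
    obtain ⟨s', hs', rfl⟩ := Finset.mem_image.1 ht
    obtain ⟨hs'T, hps'⟩ := Finset.mem_filter.1 hs'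
    suffices s' = s from this ▸ hps'
    by_contra hne
    obtain ⟨a, ha, hass⟩ := hF (s', s) hne
    have haE : a ∈ E := Finset.mem_biUnion.2 ⟨_, Finset.mk_mem_product hs'T hs, ha⟩
    have := hts a
    simp only [Finset.mem_filter, haE, true_and] at this
    exact hass this
  · exact ⟨_, Finset.mem_image_of_mem _ (Finset.mem_filter.2 ⟨hs, hps⟩), by simp⟩

section Example

variable (κ : Cardinal.{u})

/-- A well-ordered set of type the cardinal `κ^{+(n+1)}`. -/
abbrev Level (n : ℕ) : Type u := (Order.succ (Order.succ^[n] κ)).ord.ToType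

/-- Codes of points: `n`, an element of `κ^{+(n+1)}`, and a parameter for `independentFamily`. -/
abbrev ExamplePoint : Type u :=
  Σ n : ℕ, Level κ n × (Finset κ.out × Finset (Finset κ.out))

variable {κ}

open scoped Classical in
/-- The point of the Cantor cube `2^{∏ κ^{+(n+1)}}` coded by `p`. -/
noncomputable def examplePoint (e : (∀ n, Level κ n) → Set κ.out) (p : ExamplePoint κ) :
    (∀ n, Level κ n) → Bool :=
  fun g => decide (g p.1 ≤ p.2.1 ∧ independentFamily (e g) p.2.2)

theorem isZeroDimensional_set_pi_bool {I : Type u} (S : Set (I → Bool)) : IsZeroDimensional S := by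
  refine TopologicalSpace.isTopologicalBasis_of_isOpen_of_nhds (fun s hs => hs.isOpen)
    fun x V hx hV => ?_
  obtain ⟨W, hW, rfl⟩ := isOpen_induced_iff.1 hV
  obtain ⟨C, hC, hxC, hCW⟩ := compact_exists_isClopen_in_isOpen hW hx
  exact ⟨Subtype.val ⁻¹' C, hC.preimage continuous_subtype_val, hxC, Set.preimage_mono hCW⟩

theorem mk_parameters (hκ : ℵ₀ ≤ κ) : #(Finset κ.out × Finset (Finset κ.out)) = κ := by
  have : Infinite κ.out := by rw [infinite_iff, mk_out]; exact hκ
  simp [mul_eq_self hκ]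

theorem exists_injective_level (hκ : ℵ₀ ≤ κ) (h : succOmega κ ≤ 2 ^ κ) :
    ∃ e : (∀ n, Level κ n) → Set κ.out, Function.Injective e := by
  have hlevel : ∀ n, #(Level κ n) ≤ #(Set κ.out) := fun n => by
    rw [mk_ord_toType, mk_set, mk_out, ← Function.iterate_succ_apply' Order.succ]
    exact (le_ciSup (bddAbove_range_succ_iterate κ) (n + 1)).trans h
  have hpow : #(ℕ → Set κ.out) ≤ #(Set κ.out) := by
    rw [mk_arrow, mk_set, mk_out, mk_nat, lift_aleph0, lift_id'.{0, u}, ← power_mul,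
      mul_aleph0_eq hκ]
  have j : ∀ n, Level κ n ↪ Set κ.out := fun n => (hlevel n).some
  obtain ⟨e⟩ := hpow
  refine ⟨fun g => e fun n => j n (g n), fun g g' hgg' => funext fun n => (j n).injective ?_⟩
  exact congrFun (e.injective hgg') n

theorem not_dense_range_examplePoint (hκ : ℵ₀ ≤ κ) {e : (∀ n, Level κ n) → Set κ.out}
    {D : Set (Set.range (examplePoint e))} (hD : #D ≤ κ) : ¬ Dense D := by
  intro hdense
  choose p hp using fun x : Set.range (examplePoint e) => x.2
  have hbd : ∀ n, ∃ b : Level κ n, ∀ a ξ, (⟨n, a, ξ⟩ : ExamplePoint κ) ∈ p '' D → a < b :=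
    fun n => by
      obtain ⟨b, hb⟩ := exists_forall_lt_of_mk_le (hκ.trans (le_succ_iterate κ n))
        {a : Level κ n | ∃ ξ, (⟨n, a, ξ⟩ : ExamplePoint κ) ∈ p '' D} (by
          refine le_trans ?_ ((mk_image_le (f := p) (s := D)).trans (hD.trans (le_succ_iterate κ n)))
          choose ξ hξ using fun a : {a : Level κ n | ∃ ξ, (⟨n, a, ξ⟩ : ExamplePoint κ) ∈ p '' D} =>
            a.2
          refine mk_le_of_injective (f := fun a => (⟨_, hξ a⟩ : p '' D)) fun a a' h => ?_
          simp only [Subtype.mk.injEq, Sigma.mk.injEq, heq_eq_eq, true_and, Prod.mk.injEq] at h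
          exact Subtype.ext h.1)
      exact ⟨b, fun a ξ h => hb a ⟨ξ, h⟩⟩
  choose g hg using hbd
  obtain ⟨ξ, hξ⟩ := exists_independentFamily_iff {e g} fun _ => True
  obtain ⟨x, hxg, hxD⟩ := hdense.inter_open_nonempty {x | x.1 g = true}
    (isOpen_discrete ({true} : Set Bool) |>.preimage
      (f := fun x : Set.range (examplePoint e) => x.1 g)
        ((continuous_apply (A := fun _ => Bool) g).comp continuous_subtype_val))
    -- Any level would do: the bound `g n ≤ g n` is trivial.
    ⟨⟨_, ⟨0, g 0, ξ⟩, rfl⟩, by simpa [examplePoint] using hξ⟩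
  have h1 : (examplePoint e (p x)) g = true := by rw [hp]; exact hxg
  simp only [examplePoint, decide_eq_true_eq] at h1
  exact (hg _ _ _ ⟨x, hxD, rfl⟩).not_ge h1.1

theorem mk_examplePoint_lt_le (hκ : ℵ₀ ≤ κ) (n : ℕ) :
    #{p : ExamplePoint κ // p.1 < n} ≤ Order.succ^[n] κ := by
  have hκn := hκ.trans (le_succ_iterate κ n)
  let f : {p : ExamplePoint κ // p.1 < n} →
      Σ i : ULift.{u} (Fin n), Level κ i.down × (Finset κ.out × Finset (Finset κ.out)) :=
    fun p => ⟨⟨⟨p.1.1, p.2⟩⟩, p.1.2⟩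
  have hf : Function.Injective f := by
    rintro ⟨⟨i, a⟩, hi⟩ ⟨⟨i', a'⟩, hi'⟩ h
    simp only [f, Sigma.mk.injEq, ULift.up.injEq, Fin.mk.injEq] at h
    obtain ⟨rfl, h⟩ := h
    simpa using h
  refine (mk_le_of_injective hf).trans ?_
  rw [mk_sigma]
  refine (sum_le_sum _ (fun _ => Order.succ^[n] κ) fun i => ?_).trans ?_
  · rw [mk_prod, lift_id, lift_id, mk_parameters hκ, mk_ord_toType,
      ← Function.iterate_succ_apply' Order.succ]
    refine mul_le_of_le hκn ?_ (le_succ_iterate κ n)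
    exact Function.monotone_iterate_of_id_le (fun c => Order.le_succ c) i.down.2 κ
  · rw [sum_const']
    exact mul_le_of_le hκn ((lt_aleph0_of_finite _).le.trans hκn) le_rfl

theorem exists_pinsDown_range_examplePoint (hκ : ℵ₀ ≤ κ) {e : (∀ n, Level κ n) → Set κ.out}
    (he : Function.Injective e)
    (U : Set.range (examplePoint e) → Set (Set.range (examplePoint e))) (hU : IsNhdAssignment U) :
    ∃ A : Set (Set.range (examplePoint e)), #A ≤ κ ∧ PinsDown A U := by
  classical
  have hbasic : ∀ x : Set.range (examplePoint e), ∃ T : Finset (∀ n, Level κ n),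
      ∀ y : Set.range (examplePoint e), (∀ g ∈ T, y.1 g = x.1 g) → y ∈ U x := fun x => by
    obtain ⟨W, hW, hWU⟩ := isOpen_induced_iff.1 (hU x).1
    obtain ⟨T, u, hu, hTW⟩ := isOpen_pi_iff.1 hW x.1 (by
      have := (hU x).2; rw [← hWU] at this; exact this)
    refine ⟨T, fun y hy => ?_⟩
    rw [← hWU]
    exact hTW fun g hg => by rw [hy g hg]; exact (hu g hg).2
  choose T hT using hbasic
  -- Only κ^{+n} points lie below level `n`, each with a finite support `T`, while `Level κ n` has
  -- cofinality κ^{+(n+1)}.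
  have hbd : ∀ n, ∃ b : Level κ n, ∀ p : ExamplePoint κ, p.1 < n →
      ∀ g ∈ T ⟨_, p, rfl⟩, g n < b := fun n => by
    have hκn := hκ.trans (le_succ_iterate κ n)
    let S : {p : ExamplePoint κ // p.1 < n} → Set (Level κ n) :=
      fun q => (fun g : ∀ n, Level κ n => g n) '' (T ⟨_, q.1, rfl⟩ : Set (∀ n, Level κ n))
    have hS : ∀ q, #(S q) ≤ ℵ₀ := fun q =>
      (lt_aleph0_iff_set_finite.2 ((Finset.finite_toSet _).image _)).le
    have hSn : #(⋃ q, S q) ≤ Order.succ^[n] κ := by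
      refine mk_iUnion_le_sum_mk.trans ((sum_le_sum _ (fun _ => ℵ₀) hS).trans ?_)
      rw [sum_const']
      exact mul_le_of_le hκn (mk_examplePoint_lt_le hκ n) hκn
    obtain ⟨b, hb⟩ := exists_forall_lt_of_mk_le hκn _ hSn
    exact ⟨b, fun p hp g hg => hb _ (Set.mem_iUnion.2 ⟨⟨p, hp⟩, g, hg, rfl⟩)⟩
  choose h hh using hbd
  refine ⟨Set.range fun q : ULift.{u} ℕ × (Finset κ.out × Finset (Finset κ.out)) =>
    ⟨_, ⟨q.1.down, h q.1.down, q.2⟩, rfl⟩, mk_range_le.trans ?_, ?_⟩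
  · rw [mk_prod, lift_id, lift_id, mk_parameters hκ]
    exact mul_le_of_le hκ (by simpa using hκ) le_rfl
  · rintro ⟨_, p, rfl⟩
    obtain ⟨ξ, hξ⟩ := exists_independentFamily_iff ((T ⟨_, p, rfl⟩).image e)
      fun s => ∃ g, e g = s ∧ examplePoint e p g = true
    -- One level above `p`, the bound `h` dominates the support of `p`, so truncation is harmless
    -- and `ξ` alone copies the values of `p` there.
    refine ⟨_, ⟨⟨⟨p.1 + 1⟩, ξ⟩, rfl⟩, hT _ _ fun g hg => ?_⟩
    have h1 := hξ (e g) (Finset.mem_image_of_mem _ hg)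
    have h2 : (∃ g', e g' = e g ∧ examplePoint e p g' = true) ↔ examplePoint e p g = true :=
      ⟨fun ⟨g', hg', h⟩ => he hg' ▸ h, fun h => ⟨g, rfl, h⟩⟩
    rw [h2] at h1
    rw [Bool.eq_iff_iff, ← h1]
    simp [examplePoint, (hh (p.1 + 1) p (Nat.lt_succ_self _) g hg).le]

theorem exists_pinningDownNumber_lt_topDensity (h : succOmega κ ≤ 2 ^ κ) :
    ∃ (X : Type u) (_ : TopologicalSpace X), T2Space X ∧ IsZeroDimensional X ∧
      pinningDownNumber X < topDensity X := by
  have hκ : ℵ₀ ≤ κ := not_lt.1 fun hκ => (two_power_lt_succOmega_of_lt_aleph0 hκ).not_ge h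
  obtain ⟨e, he⟩ := exists_injective_level hκ h
  refine ⟨Set.range (examplePoint e), inferInstance, inferInstance,
    isZeroDimensional_set_pi_bool _, ?_⟩
  refine (pinningDownNumber_le hκ (exists_pinsDown_range_examplePoint hκ he)).trans_lt ?_
  obtain ⟨D, hD, hDκ⟩ := exists_dense_mk_eq_topDensity (X := Set.range (examplePoint e))
  by_contra! hle
  exact not_dense_range_examplePoint hκ (hDκ.le.trans hle) hD

end Example

theorem theorem1 :
    List.TFAE [
      ∀ κ : Cardinal.{u}, 2 ^ κ < succOmega κ,
      ∀ (X : Type u) [TopologicalSpace X] [T2Space X],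
        topDensity X = pinningDownNumber X,
      ∀ (X : Type u) [TopologicalSpace X] [T2Space X], IsZeroDimensional X →
        topDensity X = pinningDownNumber X] := by
  tfae_have 1 → 2 := topDensity_eq_pinningDownNumber_of_two_power_lt
  tfae_have 2 → 3 := fun h X _ _ _ => h X
  tfae_have 3 → 1 := fun h κ => by
    by_contra! hκ
    obtain ⟨X, _, _, hX, hlt⟩ := exists_pinningDownNumber_lt_topDensity hκ
    exact hlt.ne' (h X hX)
  tfae_finish
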